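/- Let $N,K,L$ be integers with $1\le K\le N$ and $K/2\le L\le K$. In the $(N,K,L)$ multi-access coded caching network a server holds $N$ files of $F$ bits each (one unit is $F$ bits); there are $K$ caches of $M$ units each and $K$ users, user $k$ having access to the $L$ consecutive caches $k,k+1,\dots,k+L-1$ (cyclically modulo $K$). Before the requests are known, every cache is filled with at most $MF$ uncoded bits of the files (uncoded placement). Then each user requests one of the $N$ files, and, depending on the placement and on the request profile, the server broadcasts to all users an error-free message of at most $RF$ bits, an arbitrary function of the files, from which, together with the content of its $L$ accessible caches, every user must recover its requested file. The pair $(R,M)$ is achievable if for every $\varepsilon>0$ and all sufficiently large $F$ some uncoded placement allows every request profile to be served with a message of at most $(R+\varepsilon)F$ bits, and $R^*(M)$ is the smallest $R$ for which $(R,M)$ is achievable. Let $$R_{ub}(M)=\begin{cases}K-\Big[K-\frac{(K-L)^2}{K}\Big]\frac{MK}{N} & \text{if } 0\le M\le \frac NK,\\[2pt] \frac{(K-L)^2}{K}\Big(2-\frac{MK}{N}\Big) & \text{if } \frac NK\le M\le\frac{2N}{K},\\[2pt] 0 & \text{if } M\ge\frac{2N}{K}.\end{cases}$$ Then for every real $M\ge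 0$ the pair $(R_{ub}(M),M)$ is achievable and $$R^*(M)\le R_{ub}(M)\le 2\,R^*(M).$$ In particular $R_{ub}(M)/R^*(M)\le 2$ whenever $R^*(M)>0$, and $R_{ub}(M)=0$ when $R^*(M)=0$. -/

import Mathlib

namespace MultiAccessCaching

/-- The content of the server: `N` files of `F` bits each. -/
abbrev Library (N F : ℕ) : Type := Fin N → Fin F → Bool

/-- An uncoded placement: each of the `K` caches stores a set of raw bits of the files, where the
pair `(n, b)` stands for bit `b` of file `n`. It depends neither on the requests nor on the
values of the bits. -/
abbrev Placement (N K F : ℕ) : Type := Fin K → Finset (Fin N × Fin F)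

/-- The caches accessed by user `k`: the `L` consecutive caches `k, k + 1, …, k + L - 1`,
with cyclic wrap-around. -/
def accessible {K : ℕ} (L : ℕ) (k : Fin K) : Finset (Fin K) :=
  Finset.univ.filter fun c => ∃ i < L, (c : ℕ) = ((k : ℕ) + i) % K

/-- What user `k` reads in its accessible caches, for a given value of the library. -/
def sideInformation {N K F : ℕ} (L : ℕ) (Z : Placement N K F) (W : Library N F) (k : Fin K) :
    (c : accessible L k) → Z c → Bool :=
  fun _ b => W b.1.1 b.1.2

/-- A delivery scheme for the placement `Z` and the request profile `d`: the server broadcasts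
`ℓ` bits, an arbitrary function of the library, and from these bits and the content of its
accessible caches every user recovers the file it requested. -/
structure DeliveryScheme {N K F : ℕ} (L : ℕ) (Z : Placement N K F) (d : Fin K → Fin N)
    (ℓ : ℕ) where
  encode : Library N F → Fin ℓ → Bool
  decode : (k : Fin K) → (Fin ℓ → Bool) → ((c : accessible L k) → Z c → Bool) → Fin F → Bool
  correct : ∀ (W : Library N F) (k : Fin K),
    decode k (encode W) (sideInformation L Z W k) = W (d k)

/-- For files of `F` bits there is an uncoded placement in caches of `M` units (`M * F` bits)
each, chosen before the requests are known, such that every request profile can be served with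
a message of at most `R` units (`R * F` bits). -/
def AchievableWithFileSize (N K L F : ℕ) (M R : ℝ) : Prop :=
  ∃ Z : Placement N K F, (∀ c, ((Z c).card : ℝ) ≤ M * F) ∧
    ∃ ℓ : ℕ, (ℓ : ℝ) ≤ R * F ∧ ∀ d : Fin K → Fin N, Nonempty (DeliveryScheme L Z d ℓ)

/-- The rate-memory pair `(R, M)` is achievable with uncoded placement: up to an arbitrarily small
excess in the rate, it is achieved for every large enough file size. -/
def Achievable (N K L : ℕ) (M R : ℝ) : Prop :=
  ∀ ε > 0, ∀ᶠ F : ℕ in Filter.atTop, AchievableWithFileSize N K L F M (R + ε)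

/-- The optimal rate-memory trade-off `R^*(M)` under uncoded placement. -/
noncomputable def optimalRate (N K L : ℕ) (M : ℝ) : ℝ :=
  sInf {R : ℝ | Achievable N K L M R}

/-- The rate `R_ub(M)`. -/
noncomputable def rateUB (N K L : ℕ) (M : ℝ) : ℝ :=
  if M ≤ N / K then
    K - (K - ((K : ℝ) - L) ^ 2 / K) * (M * K / N)
  else if M ≤ 2 * N / K then
    ((K : ℝ) - L) ^ 2 / K * (2 - M * K / N)
  else 0

end MultiAccessCaching

/-!
Put `T = K - L`, so that `2 T ≤ K`; every user lacks the content of exactly `T` caches.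

*Achievability.* The file is cut into three sections. The first is not cached at all and is sent in
the clear. The second is cut into `K` portions, cache `c` storing portion `c` of every file. A user
then lacks `T` cyclically consecutive portions, and each portion is lacked by `T` users; so among
the `K T` requested portions every user is ignorant of only `T ^ 2`, and `T ^ 2` power sums with
distinct nodes in a field of `2 ^ b` elements (a portion of `b` bits being one field element) let
every user solve for them (`servable_portions`). In the third section cache `c` stores the portions
`2 c` and `2 c + 1` modulo `K`, so that `L ≥ K / 2` consecutive caches cover everything and nothing
has to be sent (`servable_two_portions`). Choosing the sizes of the three sections is memory
sharing between `M = 0`, `N / K` and `2 N / K`, and gives `rateUB`.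

*Converse.* If the users are ranked and request distinct files, the encoder is injective on the
libraries supported on those bits that are requested by some user but cached neither at that user
nor at a user of lower rank (`card_unknown_le`). Average this acyclicity bound over the cyclic
rankings of the users that begin at a user `c₀`, and over the cyclic shifts of the files. A bit
that is not cached then has weight `K ^ 2`, a bit that is in exactly one cache has weight at least
`T ^ 2 / 2`, and for the other bits the bound `0` suffices. Twice this weight dominates each of
the lines `K ^ 2 - (K ^ 2 - T ^ 2) s` and `T ^ 2 (2 - s)` in the number `s` of caches that hold the
bit; summing a line over all bits turns it into the corresponding branch of `rateUB`
(`line_le_of_scheme`).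
-/

namespace MultiAccessCaching

open Finset

/-! ### Cyclic access -/

theorem mem_accessible_iff {K L : ℕ} [NeZero K] (hLK : L ≤ K) (k c : Fin K) :
    c ∈ accessible L k ↔ (c - k).val < L := by
  simp only [accessible, mem_filter, mem_univ, true_and]
  constructor
  · rintro ⟨i, hi, h⟩
    have hc : c = k + ⟨i, hi.trans_le hLK⟩ := Fin.ext (by rw [Fin.val_add]; exact h)
    rw [hc, add_sub_cancel_left]
    exact hi
  · intro h
    refine ⟨_, h, ?_⟩
    rw [← Fin.val_add, add_sub_cancel]

theorem card_filter_le_val {K : ℕ} (L : ℕ) (hLK : L ≤ K) :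
    #{x : Fin K | L ≤ x.val} = K - L := by
  have h : #{x : Fin K | ¬ x.val < L} = K - L := by
    rw [filter_not, card_sdiff_of_subset (filter_subset _ _), Fin.card_filter_val_lt]
    simp [hLK]
  simpa only [not_lt] using h

/-- Every user lacks `K - L` caches. -/
theorem card_filter_le_sub_left {K : ℕ} [NeZero K] (L : ℕ) (hLK : L ≤ K) (k : Fin K) :
    #{x : Fin K | L ≤ (x - k).val} = K - L := by
  rw [← card_filter_le_val L hLK]
  exact card_equiv (Equiv.subRight k) (by simp)

/-- Every cache is lacked by `K - L` users. -/
theorem card_filter_le_sub_right {K : ℕ} [NeZero K] (L : ℕ) (hLK : L ≤ K) (k : Fin K) :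
    #{x : Fin K | L ≤ (k - x).val} = K - L := by
  rw [← card_filter_le_val L hLK]
  exact card_equiv (Equiv.subLeft k) (by simp)

/-! ### Schemes over an arbitrary set of bit positions -/

/-- With the bits of each file indexed by `B`, there is an uncoded placement in caches of `m` bits
such that every request profile can be served with a message of `ℓ` bits. The message may range
over any type of at most `2 ^ ℓ` elements, and decodability is expressed as injectivity: message
and side information together determine the requested file. -/
def Servable (N K L : ℕ) (B : Type) (m ℓ : ℕ) : Prop :=
  ∃ Z : Fin K → Finset (Fin N × B), (∀ c, #(Z c) ≤ m) ∧ ∀ d : Fin K → Fin N,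
    ∃ (X : Type) (_ : Fintype X), Fintype.card X ≤ 2 ^ ℓ ∧ ∃ encode : (Fin N → B → Bool) → X,
      ∀ W W' k, encode W = encode W' →
        (∀ c ∈ accessible L k, ∀ p ∈ Z c, W p.1 p.2 = W' p.1 p.2) → W (d k) = W' (d k)

variable {N K L : ℕ}

theorem Servable.mono {B : Type} {m m' ℓ ℓ' : ℕ} (h : Servable N K L B m ℓ) (hm : m ≤ m')
    (hℓ : ℓ ≤ ℓ') : Servable N K L B m' ℓ' := by
  obtain ⟨Z, hZ, h⟩ := h
  refine ⟨Z, fun c => (hZ c).trans hm, fun d => ?_⟩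
  obtain ⟨X, _, hX, e⟩ := h d
  exact ⟨X, _, hX.trans (Nat.pow_le_pow_right two_pos hℓ), e⟩

theorem Servable.congr {B B' : Type} {m ℓ : ℕ} (h : Servable N K L B m ℓ) (e : B ≃ B') :
    Servable N K L B' m ℓ := by
  obtain ⟨Z, hZ, h⟩ := h
  refine ⟨fun c => (Z c).map ((Equiv.refl _).prodCongr e).toEmbedding,
    fun c => (card_map _).trans_le (hZ c), fun d => ?_⟩
  obtain ⟨X, _, hX, enc, henc⟩ := h d
  refine ⟨X, _, hX, fun W => enc fun n b => W n (e b), fun W W' k hW hs => ?_⟩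
  have := henc (fun n b => W n (e b)) (fun n b => W' n (e b)) k hW fun c hc p hp =>
    hs c hc (p.1, e p.2) (mem_map.2 ⟨p, hp, rfl⟩)
  funext b
  simpa using congrFun this (e.symm b)

/-- Memory sharing: the sections of the files indexed by `B` and by `B'` are treated separately. -/
theorem Servable.sum {B B' : Type} {m m' ℓ ℓ' : ℕ} (h : Servable N K L B m ℓ)
    (h' : Servable N K L B' m' ℓ') : Servable N K L (B ⊕ B') (m + m') (ℓ + ℓ') := by
  classical
  obtain ⟨Z, hZ, h⟩ := h
  obtain ⟨Z', hZ', h'⟩ := h'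
  refine ⟨fun c => (Z c).image (fun p => (p.1, Sum.inl p.2)) ∪
      (Z' c).image (fun p => (p.1, Sum.inr p.2)), fun c => ?_, fun d => ?_⟩
  · exact (card_union_le _ _).trans
      (add_le_add (card_image_le.trans (hZ c)) (card_image_le.trans (hZ' c)))
  obtain ⟨X, _, hX, enc, henc⟩ := h d
  obtain ⟨X', _, hX', enc', henc'⟩ := h' d
  refine ⟨X × X', inferInstance, ?_,
    fun W => (enc fun n b => W n (.inl b), enc' fun n b => W n (.inr b)), fun W W' k hW hs => ?_⟩
  · rw [Fintype.card_prod, pow_add]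
    exact Nat.mul_le_mul hX hX'
  · rw [Prod.mk.injEq] at hW
    have h1 := henc _ _ k hW.1 fun c hc p hp =>
      hs c hc (p.1, .inl p.2) (mem_union_left _ (mem_image_of_mem _ hp))
    have h2 := henc' _ _ k hW.2 fun c hc p hp =>
      hs c hc (p.1, .inr p.2) (mem_union_right _ (mem_image_of_mem _ hp))
    funext b
    cases b with
    | inl b => exact congrFun h1 b
    | inr b => exact congrFun h2 b

theorem Servable.achievableWithFileSize {F m ℓ : ℕ} {M R : ℝ} (h : Servable N K L (Fin F) m ℓ)
    (hm : (m : ℝ) ≤ M * F) (hℓ : (ℓ : ℝ) ≤ R * F) : AchievableWithFileSize N K L F M R := by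
  classical
  obtain ⟨Z, hZ, h⟩ := h
  refine ⟨Z, fun c => le_trans (by exact_mod_cast hZ c) hm, ℓ, hℓ, fun d => ?_⟩
  obtain ⟨X, _, hX, enc, henc⟩ := h d
  obtain ⟨φ⟩ : Nonempty (X ↪ (Fin ℓ → Bool)) :=
    Function.Embedding.nonempty_of_card_le (by simpa using hX)
  refine ⟨⟨fun W => φ (enc W), fun k y s =>
    if hW : ∃ W : Library N F, φ (enc W) = y ∧ sideInformation L Z W k = s
      then hW.choose (d k) else fun _ => false, fun W k => ?_⟩⟩
  have hW : ∃ W' : Library N F, φ (enc W') = φ (enc W) ∧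
    sideInformation L Z W' k = sideInformation L Z W k := ⟨W, rfl, rfl⟩
  rw [dif_pos hW]
  refine henc _ _ k (φ.injective hW.choose_spec.1) fun c hc p hp => ?_
  exact congrFun (congrFun hW.choose_spec.2 ⟨c, hc⟩) ⟨p, hp⟩

/-! ### The three elementary schemes -/

/-- Without caching, each user is sent its file. -/
theorem servable_uncached (B : Type) [Fintype B] :
    Servable N K L B 0 (K * Fintype.card B) := by
  classical
  refine ⟨fun _ => ∅, by simp, fun d => ⟨Fin K → B → Bool, inferInstance, ?_,
    fun W k => W (d k), fun W W' k h _ => congrFun h k⟩⟩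
  simp [← pow_mul, mul_comm]

/-- A maximum distance separable map over the alphabet of `b`-bit words: its `r` output words
determine any `r` input words, the others being known. -/
theorem exists_mds {ι : Type} [Fintype ι] (b r : ℕ) (hb : b ≠ 0) (hι : Fintype.card ι ≤ 2 ^ b) :
    ∃ f : (ι → Fin b → Bool) → (Fin r → Fin b → Bool), ∀ S : Finset ι, #S ≤ r → ∀ x y,
      (∀ i ∉ S, x i = y i) → f x = f y → x = y := by
  classical
  have hcard := GaloisField.card 2 b hb
  have : Finite (GaloisField 2 b) := Nat.finite_of_card_ne_zero (by rw [hcard]; positivity)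
  have := Fintype.ofFinite (GaloisField 2 b)
  let e : (Fin b → Bool) ≃ GaloisField 2 b :=
    (Finite.card_eq.1 (by rw [hcard]; simp)).some
  obtain ⟨α⟩ : Nonempty (ι ↪ GaloisField 2 b) :=
    Function.Embedding.nonempty_of_card_le (hι.trans (by rw [← hcard, Nat.card_eq_fintype_card]))
  refine ⟨fun x j => e.symm (∑ i, e (x i) * α i ^ (j : ℕ)), fun S hS x y hxy hf => ?_⟩
  have key : (fun j : Fin #S => e (x (S.equivFin.symm j)) - e (y (S.equivFin.symm j))) = 0 := by
    refine Matrix.eq_zero_of_forall_pow_sum_mul_pow_eq_zero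
      (f := fun j => α (S.equivFin.symm j))
      (α.injective.comp (Subtype.val_injective.comp S.equivFin.symm.injective)) fun j => ?_
    have hj := e.symm.injective (congrFun hf ⟨j, j.2.trans_le hS⟩)
    rw [← sub_eq_zero, ← sum_sub_distrib] at hj
    simp only [← sub_mul] at hj
    -- Outside `S` the two inputs agree, so only the terms of `S` survive.
    rw [← sum_subset (subset_univ S) fun i _ hi => by rw [hxy i hi, sub_self, zero_mul],
      ← sum_coe_sort S fun i => (e (x i) - e (y i)) * α i ^ (j : ℕ)] at hj
    rw [← hj]
    exact Equiv.sum_comp S.equivFin.symm fun i : S => (e (x i) - e (y i)) * α i ^ (j : ℕ)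
  funext i
  by_cases hi : i ∈ S
  · have := congrFun key (S.equivFin ⟨i, hi⟩)
    simp only [Equiv.symm_apply_apply, Pi.zero_apply, sub_eq_zero] at this
    exact e.injective this
  · exact hxy i hi

/-- Each of `K` portions of a file is in one cache, and `(K - L) ^ 2` portions are sent. -/
theorem servable_portions_of_le [NeZero K] (hLK : L ≤ K) {b : ℕ} (hb : K * K ≤ b) :
    Servable N K L (Fin K × Fin b) (N * b) ((K - L) ^ 2 * b) := by
  classical
  have hK : 0 < K := Nat.pos_of_ne_zero (NeZero.ne K)
  obtain ⟨f, hf⟩ := exists_mds (ι := Fin K × Fin K) b ((K - L) ^ 2)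
    ((Nat.mul_pos hK hK).trans_le hb).ne'
    (by simpa using hb.trans Nat.lt_two_pow_self.le)
  refine ⟨fun c => univ.image fun p : Fin N × Fin b => (p.1, c, p.2),
    fun c => card_image_le.trans (by simp), fun d => ?_⟩
  -- Input `(m, p)` is portion `p` of the file that user `m` requests, or `0` if `m` has it.
  refine ⟨Fin ((K - L) ^ 2) → Fin b → Bool, inferInstance, by simp [← pow_mul, mul_comm],
    fun W => f fun i t => if L ≤ (i.2 - i.1).val then W (d i.1) (i.2, t) else false,
    fun W W' k hW hs => ?_⟩
  have known : ∀ p : Fin K, (p - k).val < L → ∀ n t, W n (p, t) = W' n (p, t) := fun p hp n t =>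
    hs p ((mem_accessible_iff hLK k p).2 hp) (n, p, t) (mem_image.2 ⟨(n, t), mem_univ _, rfl⟩)
  -- The inputs that user `k` does not know.
  let S : Finset (Fin K × Fin K) :=
    (univ.filter fun p : Fin K => L ≤ (p - k).val).biUnion fun p =>
      (univ.filter fun m : Fin K => L ≤ (p - m).val).image fun m => (m, p)
  have hS : #S ≤ (K - L) ^ 2 := by
    refine (card_biUnion_le_card_mul _ _ (K - L) fun p _ => card_image_le.trans
      (card_filter_le_sub_right L hLK p).le).trans ?_
    rw [card_filter_le_sub_left L hLK, sq]
  have hmem : ∀ i, i ∈ S ↔ L ≤ (i.2 - k).val ∧ L ≤ (i.2 - i.1).val := by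
    rintro ⟨m, p⟩
    simp [S]
  have heq := hf S hS _ _ (fun i hi => ?_) hW
  · funext ⟨p, t⟩
    by_cases hp : (p - k).val < L
    · exact known p hp _ _
    · simpa [not_lt.1 hp] using congrFun (congrFun heq (k, p)) t
  · funext t
    split_ifs with h
    · rw [hmem, not_and'] at hi
      exact known _ (not_le.1 (hi h)) _ _
    · rfl

/-- The constant `K ^ 4` pays for sending short portions, for which the field of `2 ^ b` elements
would be too small, in the clear. -/
theorem servable_portions [NeZero K] (hLK : L ≤ K) (b : ℕ) :
    Servable N K L (Fin K × Fin b) (N * b) ((K - L) ^ 2 * b + K ^ 4) := by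
  rcases le_total (K * K) b with hb | hb
  · exact (servable_portions_of_le hLK hb).mono le_rfl (Nat.le_add_right _ _)
  · refine (servable_uncached (Fin K × Fin b)).mono (Nat.zero_le _) (le_add_left ?_)
    rw [Fintype.card_prod, Fintype.card_fin, Fintype.card_fin]
    calc K * (K * b) ≤ K * (K * (K * K)) := by gcongr
      _ = K ^ 4 := by ring

/-- If each cache holds two consecutive portions, then any `L ≥ K / 2` consecutive caches hold
the library. -/
theorem servable_two_portions [NeZero K] (hLK : L ≤ K) (hL : K ≤ 2 * L) (e : ℕ) :
    Servable N K L (Fin K × Fin e) (2 * (N * e)) 0 := by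
  classical
  refine ⟨fun c => univ.image (fun p : Fin N × Fin e => (p.1, c + c, p.2)) ∪
    univ.image (fun p : Fin N × Fin e => (p.1, c + c + 1, p.2)), fun c => ?_,
    fun d => ⟨Unit, inferInstance, by simp, fun _ => (), fun W W' k _ hs => ?_⟩⟩
  · refine (card_union_le _ _).trans ?_
    rw [two_mul]
    exact add_le_add (card_image_le.trans (by simp)) (card_image_le.trans (by simp))
  funext ⟨q, t⟩
  -- If `q = 2 k + r` with `r < K`, then `q` is in the cache `k + r / 2`.
  set r := q - (k + k) with hr
  have hrK := r.isLt
  let h : Fin K := ⟨r / 2, by omega⟩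
  have hacc : k + h ∈ accessible L k := by
    rw [mem_accessible_iff hLK, add_sub_cancel_left]
    change r.val / 2 < L
    omega
  have hq : q = k + h + (k + h) ∨ q = k + h + (k + h) + 1 := by
    have hqr : q = k + k + r := by rw [hr, add_sub_cancel]
    have hr' : r = h + h ∨ r = h + h + 1 := by
      rcases Nat.mod_two_eq_zero_or_one r.val with hp | hp
      · left
        refine Fin.ext ?_
        rw [Fin.val_add]
        change r.val = (r.val / 2 + r.val / 2) % K
        rw [Nat.mod_eq_of_lt] <;> omega
      · right
        refine Fin.ext ?_
        rw [Fin.val_add, Fin.val_add, Fin.val_one', ← Nat.add_mod]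
        change r.val = (r.val / 2 + r.val / 2 + 1) % K
        rw [Nat.mod_eq_of_lt] <;> omega
    rcases hr' with h1 | h1
    · left; rw [hqr, h1]; abel
    · right; rw [hqr, h1]; abel
  refine hs _ hacc (d k, q, t) (mem_union.2 ?_)
  rcases hq with hq | hq
  · exact .inl (mem_image.2 ⟨(d k, t), mem_univ _, by rw [hq]⟩)
  · exact .inr (mem_image.2 ⟨(d k, t), mem_univ _, by rw [hq]⟩)

/-! ### Achievability -/

/-- Memory sharing between the three elementary schemes. -/
theorem achievableWithFileSize_of_sections [NeZero K] (hLK : L ≤ K) (hL : K ≤ 2 * L)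
    {F a b e : ℕ} {M R : ℝ} (hF : a + K * b + K * e = F)
    (hM : (N : ℝ) * b + 2 * N * e ≤ M * F)
    (hR : (K : ℝ) * a + ((K : ℝ) - L) ^ 2 * b + (K : ℝ) ^ 4 ≤ R * F) :
    AchievableWithFileSize N K L F M R := by
  have h := ((servable_uncached (N := N) (K := K) (L := L) (Fin a)).sum
    (servable_portions hLK b)).sum (servable_two_portions hLK hL e)
  refine (h.congr (Fintype.equivFinOfCardEq (by simpa using hF))).achievableWithFileSize ?_ ?_
  · push_cast
    linarith
  · push_cast [Fintype.card_fin, Nat.cast_sub hLK]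
    linarith

theorem achievable_of_forall_exists_sections [NeZero K] (hLK : L ≤ K) (hL : K ≤ 2 * L)
    {M R : ℝ} (C : ℝ) (h : ∀ F : ℕ, ∃ a b e : ℕ, a + K * b + K * e = F ∧
      (N : ℝ) * b + 2 * N * e ≤ M * F ∧ (K : ℝ) * a + ((K : ℝ) - L) ^ 2 * b ≤ R * F + C) :
    Achievable N K L M R := by
  intro ε hε
  filter_upwards [Filter.eventually_ge_atTop ⌈(C + (K : ℝ) ^ 4) / ε⌉₊] with F hF
  obtain ⟨a, b, e, hs, hM, hR⟩ := h F
  refine achievableWithFileSize_of_sections hLK hL hs hM ?_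
  have := (div_le_iff₀ hε).1 (Nat.ceil_le.1 hF)
  linarith

theorem achievable_rateUB [NeZero K] (hN : 0 < N) (hLK : L ≤ K) (hL : K ≤ 2 * L)
    {M : ℝ} (hM : 0 ≤ M) : Achievable N K L M (rateUB N K L M) := by
  have hK : 0 < K := Nat.pos_of_ne_zero (NeZero.ne K)
  have hK' : (0 : ℝ) < K := by exact_mod_cast hK
  have hN' : (0 : ℝ) < N := by exact_mod_cast hN
  have hmod : ∀ F : ℕ, ((F % K : ℕ) : ℝ) ≤ K := fun F => by exact_mod_cast (F.mod_lt hK).le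
  unfold rateUB
  split_ifs with h1 h2
  · refine achievable_of_forall_exists_sections hLK hL ((K : ℝ) ^ 2) fun F => ?_
    rw [le_div_iff₀ hK'] at h1
    have hF := Nat.cast_nonneg (α := ℝ) F
    have hx : 0 ≤ M * F / N := by positivity
    have hb := Nat.floor_le hx
    have hb' := (Nat.lt_floor_add_one (M * F / N)).le
    set b := ⌊M * F / N⌋₊
    have hbM : (N : ℝ) * b ≤ M * F := by rw [le_div_iff₀ hN'] at hb; linarith
    have hKb : K * b ≤ F := by
      have : (K * b : ℝ) ≤ F := by
        refine le_of_mul_le_mul_left ?_ hN'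
        nlinarith
      exact_mod_cast this
    refine ⟨F - K * b, b, 0, by omega, by simpa using hbM, ?_⟩
    rw [Nat.cast_sub hKb]
    push_cast
    have e1 : (K - (K - ((K : ℝ) - L) ^ 2 / K) * (M * K / N)) * F =
        K * F - ((K : ℝ) ^ 2 - ((K : ℝ) - L) ^ 2) * (M * F / N) := by
      field_simp
    rw [e1]
    nlinarith [sq_nonneg ((K : ℝ) - L)]
  · refine achievable_of_forall_exists_sections hLK hL ((K : ℝ) ^ 2 + ((K : ℝ) - L) ^ 2)
      fun F => ?_
    push Not at h1
    rw [div_lt_iff₀ hK'] at h1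
    rw [le_div_iff₀ hK'] at h2
    have hF := Nat.cast_nonneg (α := ℝ) F
    -- The sizes solve `b + e = F / K` and `N b + 2 N e = M F`, up to rounding.
    have hx : 0 ≤ (M * K - N) * F / (N * K) :=
      div_nonneg (mul_nonneg (by linarith) hF) (by positivity)
    have he := Nat.floor_le hx
    have he' := (Nat.lt_floor_add_one ((M * K - N) * F / (N * K))).le
    set e := ⌊(M * K - N) * F / (N * K)⌋₊
    have heM : (e : ℝ) * (N * K) ≤ (M * K - N) * F := by rwa [le_div_iff₀ (by positivity)] at he
    have heF : e ≤ F / K := by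
      rw [Nat.le_div_iff_mul_le hK]
      have : (e * K : ℝ) ≤ F := by
        refine le_of_mul_le_mul_left ?_ hN'
        nlinarith
      exact_mod_cast this
    have hdiv : ((F / K : ℕ) : ℝ) * K ≤ F := by exact_mod_cast Nat.div_mul_le_self F K
    refine ⟨F % K, F / K - e, e, ?_, ?_, ?_⟩
    · have := Nat.mod_add_div F K
      rw [add_assoc, ← mul_add, Nat.sub_add_cancel heF, this]
    · rw [Nat.cast_sub heF]
      refine le_of_mul_le_mul_left ?_ hK'
      nlinarith
    · rw [Nat.cast_sub heF]
      have e1 : ((K : ℝ) - L) ^ 2 / K * (2 - M * K / N) * F =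
          ((K : ℝ) - L) ^ 2 * (F / K - (M * K - N) * F / (N * K)) := by
        field_simp
        ring
      have hdiv' : ((F / K : ℕ) : ℝ) ≤ F / K := by rwa [le_div_iff₀ hK']
      rw [e1]
      have := mul_le_mul_of_nonneg_left (show ((F / K : ℕ) : ℝ) - e ≤
        F / K - (M * K - N) * F / (N * K) + 1 by linarith) (sq_nonneg ((K : ℝ) - L))
      nlinarith [hmod F]
  · refine achievable_of_forall_exists_sections hLK hL ((K : ℝ) ^ 2) fun F => ?_
    push Not at h2
    rw [div_lt_iff₀ hK'] at h2
    have hF := Nat.cast_nonneg (α := ℝ) F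
    have hdiv : ((F / K : ℕ) : ℝ) * K ≤ F := by exact_mod_cast Nat.div_mul_le_self F K
    refine ⟨F % K, 0, F / K, ?_, ?_, ?_⟩
    · rw [mul_zero, add_zero, Nat.mod_add_div]
    · refine le_of_mul_le_mul_left ?_ hK'
      push_cast
      nlinarith
    · push_cast
      nlinarith [hmod F]

/-! ### The acyclicity bound -/

/-- The encoder is injective on the libraries supported on the bits that some user requests but
finds neither in its own caches nor in those of the users of lower rank: by induction on the rank,
a user knows all the requested files of lower rank, hence its side information, hence its file. -/
theorem card_unknown_le {F ℓ : ℕ} {Z : Placement N K F} {d : Fin K → Fin N}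
    (D : DeliveryScheme L Z d ℓ) (hd : Function.Injective d) (rank : Fin K → ℕ) :
    #{p : Fin K × Fin F | ∀ j, rank j ≤ rank p.1 → ∀ c ∈ accessible L j, (d p.1, p.2) ∉ Z c}
      ≤ ℓ := by
  classical
  set S : Finset (Fin K × Fin F) :=
    {p | ∀ j, rank j ≤ rank p.1 → ∀ c ∈ accessible L j, (d p.1, p.2) ∉ Z c} with hS
  let S' : Finset (Fin N × Fin F) := S.image fun p => (d p.1, p.2)
  have hcard : #S' = #S := card_image_of_injective _ fun p q h => by
    simp only [Prod.mk.injEq] at h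
    exact Prod.ext (hd h.1) h.2
  let lib : (S' → Bool) → Library N F := fun x n b =>
    if h : (n, b) ∈ S' then x ⟨(n, b), h⟩ else false
  have hinj : Function.Injective fun x => D.encode (lib x) := by
    intro x y hxy
    have key : ∀ r k, rank k = r → lib x (d k) = lib y (d k) := by
      intro r
      induction r using Nat.strong_induction_on with
      | _ r ih =>
        intro k hk
        have hside : sideInformation L Z (lib x) k = sideInformation L Z (lib y) k := by
          funext c
          funext ⟨⟨n, b⟩, hb⟩
          change lib x n b = lib y n b
          by_cases hn : (n, b) ∈ S'
          · obtain ⟨⟨j, b'⟩, hj, hjn⟩ := mem_image.1 hn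
            obtain ⟨rfl, rfl⟩ := Prod.mk.injEq _ _ _ _ ▸ hjn
            rw [hS, mem_filter] at hj
            have hlt : rank j < r := by
              by_contra hge
              exact hj.2 k (hk.trans_le (not_lt.1 hge)) c c.2 hb
            exact congrFun (ih _ hlt j rfl) _
          · simp only [lib, dif_neg hn]
        have hx := D.correct (lib x) k
        have hy := D.correct (lib y) k
        rw [← hx, ← hy, hside]
        exact congrArg (fun z => D.decode k z _) hxy
    funext ⟨⟨n, b⟩, hn⟩
    obtain ⟨⟨j, b'⟩, -, hjn⟩ := mem_image.1 hn
    obtain ⟨rfl, rfl⟩ := Prod.mk.injEq _ _ _ _ ▸ hjn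
    have := congrFun (key _ j rfl) b'
    simpa only [lib, dif_pos hn] using this
  have h := Fintype.card_le_of_injective _ hinj
  simp only [Fintype.card_fun, Fintype.card_bool, Fintype.card_coe, Fintype.card_fin, hcard] at h
  exact (Nat.pow_le_pow_iff_right (by norm_num)).1 h

/-! ### Averaging over cyclic shifts -/

open Classical in
/-- The number of pairs `(c₀, k)` such that, among the caches `S` that hold some bit, none is
accessible to one of the users `c₀, c₀ + 1, …, k`. -/
noncomputable def weight (L : ℕ) (S : Finset (Fin K)) : ℕ :=
  #{q : Fin K × Fin K | ∀ j, (j - q.1).val ≤ (q.2 - q.1).val → ∀ c ∈ accessible L j, c ∉ S}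

theorem weight_empty : weight L (∅ : Finset (Fin K)) = K ^ 2 := by
  simp [weight, sq]

/-- The pairs `(s - y, s - y + x)` with `x + L ≤ y < K` count for a bit that only cache `s`
holds. -/
theorem sq_le_two_mul_weight_singleton [NeZero K] (hLK : L ≤ K) (s : Fin K) :
    (K - L) ^ 2 ≤ 2 * weight L {s} := by
  classical
  let P : Finset (Σ _ : ℕ, ℕ) := (range (K - L)).sigma fun i => range (i + 1)
  have hP : ∀ T : ℕ, T ^ 2 ≤ 2 * ∑ i ∈ range T, (i + 1) := by
    intro T
    induction T with
    | zero => simp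
    | succ T ih => rw [sum_range_succ]; nlinarith
  have hcard : #P = ∑ i ∈ range (K - L), (i + 1) := by simp [P]
  refine (hP (K - L)).trans (Nat.mul_le_mul_left 2 (hcard.symm.trans_le ?_))
  have hlt : ∀ p ∈ P, p.2 ≤ p.1 ∧ p.1 + L < K := by
    intro p hp
    simp only [P, mem_sigma, mem_range] at hp
    omega
  refine card_le_card_of_injOn (fun p => (s - Fin.ofNat K (p.1 + L),
    s - Fin.ofNat K (p.1 + L) + Fin.ofNat K p.2)) (fun p hp => ?_) fun p hp q hq h => ?_
  · obtain ⟨h1, h2⟩ := hlt p hp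
    simp only [coe_filter, Set.mem_ofPred_eq, mem_univ, true_and, mem_singleton]
    rintro j hj c hc rfl
    rw [mem_accessible_iff hLK] at hc
    rw [add_sub_cancel_left] at hj
    set y : Fin K := Fin.ofNat K (p.1 + L) with hy
    have hyv : y.val = p.1 + L := Nat.mod_eq_of_lt h2
    have hxv : (Fin.ofNat K p.2 : Fin K).val = p.2 := Nat.mod_eq_of_lt (by omega)
    set z := j - (c - y) with hz
    have hcj : c - j = y - z := by rw [hz]; abel
    rw [hxv] at hj
    rw [hcj, Fin.sub_val_of_le (Fin.le_def.2 (by omega))] at hc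
    omega
  · obtain ⟨h1, h2⟩ := hlt p hp
    obtain ⟨h3, h4⟩ := hlt q hq
    simp only [Prod.mk.injEq] at h
    obtain ⟨ha, hb⟩ := h
    rw [ha, add_right_inj] at hb
    rw [sub_right_inj] at ha
    have ha := congrArg Fin.val ha
    have hb := congrArg Fin.val hb
    simp only [Fin.val_ofNat] at ha hb
    rw [Nat.mod_eq_of_lt h2, Nat.mod_eq_of_lt h4] at ha
    rw [Nat.mod_eq_of_lt (by omega), Nat.mod_eq_of_lt (by omega)] at hb
    exact Sigma.ext (by omega) (heq_of_eq hb)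

/-- The caches that hold a given bit. -/
def holders {F : ℕ} (Z : Placement N K F) (p : Fin N × Fin F) : Finset (Fin K) := {c | p ∈ Z c}

theorem sum_card_holders {F : ℕ} (Z : Placement N K F) :
    ∑ p, #(holders Z p) = ∑ c, #(Z c) := by
  simp only [holders, card_filter]
  rw [sum_comm]
  simp

/-- The acyclicity bound, averaged over the cyclic rankings of the users and over the cyclic
shifts of the requested files. -/
theorem sum_weight_le [NeZero K] (hKN : K ≤ N) {F ℓ : ℕ} {Z : Placement N K F}
    (h : ∀ d : Fin K → Fin N, Nonempty (DeliveryScheme L Z d ℓ)) :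
    ∑ p, weight L (holders Z p) ≤ K * N * ℓ := by
  classical
  have : NeZero N := ⟨fun h0 => NeZero.ne K (by omega)⟩
  let P : Fin K → Fin K → Fin N × Fin F → Prop := fun c₀ k p =>
    ∀ j, (j - c₀).val ≤ (k - c₀).val → ∀ c ∈ accessible L j, p ∉ Z c
  let file : Fin K → Fin K → Fin N := fun c₀ k => Fin.castLE hKN (k - c₀)
  have hbound : ∀ c₀ n₀, ∑ k, ∑ b, (if P c₀ k (n₀ + file c₀ k, b) then 1 else 0) ≤ ℓ := by
    intro c₀ n₀
    obtain ⟨D⟩ := h fun k => n₀ + file c₀ k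
    have hinj : Function.Injective fun k => n₀ + file c₀ k := fun k k' hk =>
      sub_left_injective (Fin.castLE_injective hKN (add_right_injective n₀ hk))
    have := card_unknown_le D hinj fun k => (k - c₀).val
    rwa [card_filter, Fintype.sum_prod_type] at this
  calc ∑ p, weight L (holders Z p)
      = ∑ p, ∑ c₀, ∑ k, (if P c₀ k p then 1 else 0) := by
        refine sum_congr rfl fun p _ => ?_
        rw [weight, card_filter, Fintype.sum_prod_type]
        simp [P, holders]
    _ = ∑ c₀, ∑ k, ∑ n, ∑ b, (if P c₀ k (n, b) then 1 else 0) := by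
        rw [sum_comm]
        refine sum_congr rfl fun c₀ _ => ?_
        rw [sum_comm]
        exact sum_congr rfl fun k _ => Fintype.sum_prod_type _
    _ = ∑ c₀, ∑ k, ∑ n₀, ∑ b, (if P c₀ k (n₀ + file c₀ k, b) then 1 else 0) := by
        refine sum_congr rfl fun c₀ _ => sum_congr rfl fun k _ => ?_
        exact (Equiv.sum_comp (Equiv.addRight (file c₀ k))
          fun n => ∑ b, (if P c₀ k (n, b) then 1 else 0)).symm
    _ = ∑ c₀, ∑ n₀, ∑ k, ∑ b, (if P c₀ k (n₀ + file c₀ k, b) then 1 else 0) :=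
        sum_congr rfl fun c₀ _ => sum_comm
    _ ≤ ∑ _c₀ : Fin K, ∑ _n₀ : Fin N, ℓ :=
        sum_le_sum fun c₀ _ => sum_le_sum fun n₀ _ => hbound c₀ n₀
    _ = K * N * ℓ := by simp [mul_assoc]

/-! ### The converse -/

/-- A line `A - B s` that lies below twice the weight of a bit held by `s` caches yields a lower
bound on the length of the message. -/
theorem line_le_of_scheme [NeZero K] (hKN : K ≤ N) (hLK : L ≤ K) {F ℓ : ℕ}
    {Z : Placement N K F} {M A B : ℝ} (hZ : ∀ c, (#(Z c) : ℝ) ≤ M * F)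
    (h : ∀ d : Fin K → Fin N, Nonempty (DeliveryScheme L Z d ℓ))
    (hB : 0 ≤ B) (h0 : A ≤ 2 * (K : ℝ) ^ 2) (h1 : A - B ≤ ((K : ℝ) - L) ^ 2)
    (h2 : A - 2 * B ≤ 0) :
    A * (N * F) - B * (K * (M * F)) ≤ 2 * (K * N * ℓ) := by
  have hbit : ∀ S : Finset (Fin K), A - B * #S ≤ 2 * (weight L S : ℝ) := by
    intro S
    rcases Nat.lt_or_ge 1 #S with hS | hS
    · have hS' : (2 : ℝ) ≤ #S := by exact_mod_cast hS
      have := mul_le_mul_of_nonneg_left hS' hB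
      have := Nat.cast_nonneg (α := ℝ) (weight L S)
      linarith
    · rcases Nat.le_one_iff_eq_zero_or_eq_one.1 hS with hS | hS
      · obtain rfl := card_eq_zero.1 hS
        rw [weight_empty]
        simpa using h0
      · obtain ⟨s, rfl⟩ := card_eq_one.1 hS
        have := Nat.cast_le (α := ℝ).2 (sq_le_two_mul_weight_singleton hLK s)
        push_cast [Nat.cast_sub hLK] at this
        rw [hS]
        push_cast
        linarith
  have hsum := sum_le_sum fun p (_ : p ∈ univ) => hbit (holders Z p)
  rw [sum_sub_distrib, ← mul_sum, ← mul_sum] at hsum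
  have hw : (∑ p, (weight L (holders Z p) : ℝ)) ≤ K * N * ℓ := by
    exact_mod_cast sum_weight_le hKN h
  have hc : (∑ p, (#(holders Z p) : ℝ)) ≤ K * (M * F) := by
    have e : (∑ p, (#(holders Z p) : ℝ)) = ∑ c, (#(Z c) : ℝ) := by
      exact_mod_cast sum_card_holders Z
    rw [e]
    simpa using sum_le_sum fun c (_ : c ∈ univ) => hZ c
  have := mul_le_mul_of_nonneg_left hc hB
  simp only [sum_const, card_univ, Fintype.card_prod, Fintype.card_fin, nsmul_eq_mul,
    Nat.cast_mul] at hsum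
  linarith

theorem rateUB_le_two_mul [NeZero K] (hKN : K ≤ N) (hLK : L ≤ K) (hL : (K : ℝ) / 2 ≤ L)
    {M R : ℝ} (h : Achievable N K L M R) : rateUB N K L M ≤ 2 * R := by
  have hK' : (0 : ℝ) < K := by exact_mod_cast Nat.pos_of_ne_zero (NeZero.ne K)
  have hN' : (0 : ℝ) < N := hK'.trans_le (by exact_mod_cast hKN)
  have hLK' : (L : ℝ) ≤ K := by exact_mod_cast hLK
  have hT : 2 * ((K : ℝ) - L) ^ 2 ≤ (K : ℝ) ^ 2 := by nlinarith
  refine le_of_forall_pos_le_add fun ε hε => ?_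
  obtain ⟨F, hF, Z, hZ, ℓ, hℓ, hD⟩ :=
    ((Filter.eventually_gt_atTop 0).and (h (ε / 2) (half_pos hε))).exists
  have hF' : (0 : ℝ) < F := by exact_mod_cast hF
  have key : rateUB N K L M * F ≤ 2 * ℓ := by
    refine le_of_mul_le_mul_left ?_ (mul_pos hK' hN')
    unfold rateUB
    split_ifs with h1 h2
    · have := line_le_of_scheme (A := (K : ℝ) ^ 2) (B := (K : ℝ) ^ 2 - ((K : ℝ) - L) ^ 2)
        hKN hLK hZ hD (by nlinarith) (by nlinarith) (by linarith) (by linarith)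
      refine le_trans (le_of_eq ?_) (this.trans_eq (by ring))
      field_simp
    · have := line_le_of_scheme (A := 2 * ((K : ℝ) - L) ^ 2) (B := ((K : ℝ) - L) ^ 2)
        hKN hLK hZ hD (by positivity) (by nlinarith) (by linarith) (by linarith)
      refine le_trans (le_of_eq ?_) (this.trans_eq (by ring))
      field_simp
    · rw [zero_mul, mul_zero]
      positivity
  refine le_of_mul_le_mul_right ?_ hF'
  linarith

end MultiAccessCaching

theorem corollary2 (N K L : ℕ) (hK : 1 ≤ K) (hKN : K ≤ N) (hLK : L ≤ K) (hL : (K : ℝ) / 2 ≤ L)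
    (M : ℝ) (hM : 0 ≤ M) :
    MultiAccessCaching.Achievable N K L M (MultiAccessCaching.rateUB N K L M) ∧
    MultiAccessCaching.optimalRate N K L M ≤ MultiAccessCaching.rateUB N K L M ∧
    MultiAccessCaching.rateUB N K L M ≤ 2 * MultiAccessCaching.optimalRate N K L M := by
  have : NeZero K := ⟨by omega⟩
  have hL' : K ≤ 2 * L := by
    have : (K : ℝ) ≤ 2 * L := by linarith
    exact_mod_cast this
  have hach := MultiAccessCaching.achievable_rateUB (by omega : 0 < N) hLK hL' hM
  have hlow : ∀ R ∈ {R : ℝ | MultiAccessCaching.Achievable N K L M R},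
      MultiAccessCaching.rateUB N K L M / 2 ≤ R := fun R hR => by
    have := MultiAccessCaching.rateUB_le_two_mul hKN hLK hL hR
    linarith
  refine ⟨hach, csInf_le ⟨_, hlow⟩ hach, ?_⟩
  have := le_csInf ⟨_, hach⟩ hlow
  rw [MultiAccessCaching.optimalRate]
  linarith
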